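/- Let $(\widehat M,\widehat g)$ be a semi-Riemannian manifold (a finite-dimensional smooth manifold with a smooth, symmetric, nondegenerate $(0,2)$-tensor field $\widehat g$) and let $F:\widehat M\to\mathbb R$ be a smooth function. Let $\overline M=\mathbb R\times\widehat M$ with the semi-Riemannian metric $\overline g=-dx^0\otimes dx^0+\pi^*\widehat g$, where $x^0$ is the coordinate on $\mathbb R$ and $\pi:\overline M\to\widehat M$ is the projection, and let $M=\{(t,p)\in\overline M : t=F(p)\}$ be the associated Monge-type hypersurface, with the induced (possibly degenerate) metric $g=i^*\overline g$, where $i:M\hookrightarrow\overline M$ is the inclusion. Let $\overline\nabla$ and $\widehat\nabla$ be the Levi-Civita connections of $\overline g$ and $\widehat g$. For a local section $\xi$ of the normal line bundle $TM^\perp\subset T\overline M|_M$, put $B_\xi(X,Y)=\overline g(\overline\nabla_XY,\xi)$ for local vector fields $X,Y$ tangent to $M$. The hypersurface $M$ is called totally umbilical in $\overline M$ if every point of $M$ has a neighborhood in $M$ on which there are a nowhere vanishing smooth section $\xi$ of $TM^\perp$ and a smooth function $\rho$ with $B_\xi=\rho\, g$. Let $\mathrm{Hess}(F)(X,Y)=X(YF)-(\widehat\nabla_XY)F$.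 Then $M$ is totally umbilical in $\overline M$ if and only if for every $p\in\widehat M$ there exist an open neighborhood $\widehat U$ of $p$ and a smooth function $\widehat\rho\in C^\infty(\widehat U)$ such that $$\mathrm{Hess}(F)=\widehat\rho\,\bigl(dF\otimes dF-\widehat g\bigr)\qquad\text{on }\widehat U.$$ -/

import Mathlib

open scoped Manifold ContDiff Topology

noncomputable section

open Bundle FiberBundle VectorField


/-- The pullback `f^* b` of a field of bilinear forms `b` on `M` along `f : N → M`. -/
def pullbackForm {E : Type*} [NormedAddCommGroup E] [NormedSpace ℝ E]
    {H : Type*} [TopologicalSpace H] (I : ModelWithCorners ℝ E H)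
    {M : Type*} [TopologicalSpace M] [ChartedSpace H M]
    {E' : Type*} [NormedAddCommGroup E'] [NormedSpace ℝ E']
    {H' : Type*} [TopologicalSpace H'] (J : ModelWithCorners ℝ E' H')
    {N : Type*} [TopologicalSpace N] [ChartedSpace H' N] (f : N → M)
    (b : Π x : M, TangentSpace I x →L[ℝ] TangentSpace I x →L[ℝ] ℝ) (q : N) :
    TangentSpace J q →L[ℝ] TangentSpace J q →L[ℝ] ℝ :=
  (ContinuousLinearMap.precomp ℝ (mfderiv J I f q)) ∘L b (f q) ∘L mfderiv J I f q

theorem contMDiff_pullbackForm {E : Type*} [NormedAddCommGroup E] [NormedSpace ℝ E]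
    {H : Type*} [TopologicalSpace H] {I : ModelWithCorners ℝ E H}
    {M : Type*} [TopologicalSpace M] [ChartedSpace H M] [IsManifold I ∞ M]
    {E' : Type*} [NormedAddCommGroup E'] [NormedSpace ℝ E']
    {H' : Type*} [TopologicalSpace H'] {J : ModelWithCorners ℝ E' H'}
    {N : Type*} [TopologicalSpace N] [ChartedSpace H' N] [IsManifold J ∞ N] {f : N → M}
    {b : Π x : M, TangentSpace I x →L[ℝ] TangentSpace I x →L[ℝ] ℝ}
    (hf : ContMDiff J I ∞ f)
    (hb : ContMDiff I (I.prod 𝓘(ℝ, E →L[ℝ] E →L[ℝ] ℝ)) ∞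
      (fun x : M ↦ TotalSpace.mk' (E →L[ℝ] E →L[ℝ] ℝ)
        (E := fun x : M ↦ TangentSpace I x →L[ℝ] TangentSpace I x →L[ℝ] ℝ) x (b x))) :
    ContMDiff J (J.prod 𝓘(ℝ, E' →L[ℝ] E' →L[ℝ] ℝ)) ∞
      (fun q : N ↦ TotalSpace.mk' (E' →L[ℝ] E' →L[ℝ] ℝ)
        (E := fun q : N ↦ TangentSpace J q →L[ℝ] TangentSpace J q →L[ℝ] ℝ) q
        (pullbackForm I J f b q)) := by
  intro q₀
  rw [contMDiffAt_hom_bundle]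
  refine ⟨contMDiffAt_id, ?_⟩
  have hG := ((contMDiffAt_hom_bundle _).1 (hb (f q₀))).2.comp q₀ (hf q₀)
  have hD := (hf q₀).mfderiv_const (m := ∞) (by simp)
  have hcomp := (hD.clm_precomp (F₃ := ℝ)).clm_comp (hG.clm_comp hD)
  refine hcomp.congr_of_eventuallyEq ?_
  have h1 : ∀ᶠ q in 𝓝 q₀, q ∈ (trivializationAt E' (TangentSpace J) q₀).baseSet :=
    (trivializationAt E' (TangentSpace J) q₀).open_baseSet.mem_nhds
      (mem_baseSet_trivializationAt ..)
  have h2 : ∀ᶠ q in 𝓝 q₀, f q ∈ (trivializationAt E (TangentSpace I) (f q₀)).baseSet :=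
    hf.continuous.continuousAt ((trivializationAt E (TangentSpace I) (f q₀)).open_baseSet.mem_nhds
      (mem_baseSet_trivializationAt ..))
  filter_upwards [h1, h2] with q hq hq'
  ext v w
  simp only [ContinuousLinearMap.comp_apply, ContinuousLinearMap.precomp_apply, Function.comp_apply]
  erw [inCoordinates_apply_eq₂ hq hq (by simp), inCoordinates_apply_eq₂ hq' hq' (by simp)]
  simp [inTangentCoordinates, ContinuousLinearMap.inCoordinates, pullbackForm]
  rw [Trivialization.symm_linearMapAt _ hq', Trivialization.symm_linearMapAt _ hq',
    Trivialization.symmL_apply _ hq, Trivialization.symmL_apply _ hq]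

/-- A semi-Riemannian metric on a manifold `M`: a smooth symmetric `(0,2)`-tensor field that is
nondegenerate at each point.  No signature is prescribed (the index is locally constant). -/
structure SemiRiemannianMetric {E : Type*} [NormedAddCommGroup E] [NormedSpace ℝ E]
    {H : Type*} [TopologicalSpace H] (I : ModelWithCorners ℝ E H)
    (M : Type*) [TopologicalSpace M] [ChartedSpace H M] [IsManifold I ∞ M] where
  /-- The bilinear form on each tangent space. -/
  form (x : M) : TangentSpace I x →L[ℝ] TangentSpace I x →L[ℝ] ℝ
  symm (x : M) (v w : TangentSpace I x) : form x v w = form x w v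
  nondegenerate (x : M) (v : TangentSpace I x) (h : ∀ w : TangentSpace I x, form x v w = 0) : v = 0
  contMDiff : ContMDiff I (I.prod 𝓘(ℝ, E →L[ℝ] E →L[ℝ] ℝ)) ∞
    (fun x : M ↦ TotalSpace.mk' (E →L[ℝ] E →L[ℝ] ℝ)
      (E := fun x : M ↦ TangentSpace I x →L[ℝ] TangentSpace I x →L[ℝ] ℝ) x (form x))

namespace SemiRiemannianMetric

variable {E : Type*} [NormedAddCommGroup E] [NormedSpace ℝ E]
  {H : Type*} [TopologicalSpace H] {I : ModelWithCorners ℝ E H}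
  {M : Type*} [TopologicalSpace M] [ChartedSpace H M] [IsManifold I ∞ M]
  (g : SemiRiemannianMetric I M)

theorem mdifferentiableAt_form {X Y : Π x : M, TangentSpace I x} {x : M}
    (hX : MDiffAt (T% X) x) (hY : MDiffAt (T% Y) x) :
    MDiffAt (fun y ↦ g.form y (X y) (Y y)) x := by
  have : MDifferentiableAt I (I.prod 𝓘(ℝ))
      (fun m ↦ TotalSpace.mk' ℝ (E := Bundle.Trivial M ℝ) m (g.form m (X m) (Y m))) x := by
    apply MDifferentiableAt.clm_bundle_apply₂ (F₁ := E) (F₂ := E)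
    · exact (g.contMDiff x).mdifferentiableAt (by simp)
    · exact hX
    · exact hY
  simp only [mdifferentiableAt_totalSpace] at this
  exact this.2

theorem ext_form {x : M} {v w : TangentSpace I x}
    (h : ∀ Z : Π x : M, TangentSpace I x, MDiffAt (T% Z) x →
      g.form x v (Z x) = g.form x w (Z x)) : v = w := by
  rw [← sub_eq_zero]
  refine g.nondegenerate x _ fun z ↦ ?_
  have := h (extend E z) (mdifferentiableAt_extend ..)
  simp only [extend_apply_self] at this
  simp [this]

theorem mdifferentiableAt_mvfderiv_apply {F : M → ℝ} (hF : ContMDiff I 𝓘(ℝ) ∞ F)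
    {Y : Π x : M, TangentSpace I x} {x : M} (hY : MDiffAt (T% Y) x) :
    MDiffAt (fun y ↦ d% F y (Y y)) x := by
  have h1 := (hF.contMDiff_tangentMap (m := ∞) (by simp)).mdifferentiable (by simp)
  have h2 := (h1 (⟨x, Y x⟩ : TangentBundle I M)).comp x hY
  rw [mdifferentiableAt_totalSpace] at h2
  refine h2.2.congr_of_eventuallyEq (Filter.Eventually.of_forall fun y ↦ ?_)
  simp [tangentMap, mvfderiv]
  rfl

variable [FiniteDimensional ℝ E]

/-- The linear isomorphism `T_x M ≃ (T_x M)*`, `v ↦ g(v, ·)`. -/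
def flat (x : M) : TangentSpace I x ≃ₗ[ℝ] (TangentSpace I x →L[ℝ] ℝ) :=
  haveI : FiniteDimensional ℝ (TangentSpace I x) := inferInstanceAs (FiniteDimensional ℝ E)
  haveI : T2Space (TangentSpace I x) := inferInstanceAs (T2Space E)
  haveI : FiniteDimensional ℝ (TangentSpace I x →L[ℝ] ℝ) :=
    inferInstanceAs (FiniteDimensional ℝ (E →L[ℝ] ℝ))
  LinearMap.linearEquivOfInjective
    (g.form x : TangentSpace I x →ₗ[ℝ] (TangentSpace I x →L[ℝ] ℝ))
    ((injective_iff_map_eq_zero _).2 fun v hv ↦ g.nondegenerate x v fun w ↦ by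
      have := congrArg (fun l : TangentSpace I x →L[ℝ] ℝ ↦ l w) hv
      simpa using this)
    (by
      rw [← (LinearMap.toContinuousLinearMap (𝕜 := ℝ) (E := TangentSpace I x)
        (F' := ℝ)).finrank_eq, Module.finrank_linearMap, Module.finrank_self, mul_one])

@[simp] theorem flat_apply (x : M) (v : TangentSpace I x) : g.flat x v = g.form x v := rfl

theorem form_flat_symm (x : M) (l : TangentSpace I x →L[ℝ] ℝ) :
    g.form x ((g.flat x).symm l) = l := by
  rw [← flat_apply, LinearEquiv.apply_symm_apply]

/-- The right-hand side of the Koszul formula,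
`X g(Y,Z) + Y g(X,Z) - Z g(X,Y) + g([X,Y],Z) - g([X,Z],Y) - g([Y,Z],X)`, at the point `x`. -/
def koszul (X Y Z : Π x : M, TangentSpace I x) (x : M) : ℝ :=
  d% (fun y ↦ g.form y (Y y) (Z y)) x (X x) + d% (fun y ↦ g.form y (X y) (Z y)) x (Y x)
    - d% (fun y ↦ g.form y (X y) (Y y)) x (Z x)
    + g.form x (mlieBracket I X Y x) (Z x) - g.form x (mlieBracket I X Z x) (Y x)
    - g.form x (mlieBracket I Y Z x) (X x)

theorem tensorialAt_koszul_left {Y Z : Π x : M, TangentSpace I x} {x : M}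
    (hY : MDiffAt (T% Y) x) (hZ : MDiffAt (T% Z) x) :
    TensorialAt I E (fun X ↦ g.koszul X Y Z x) x where
  smul {f X} hf hX := by
    have e (W : Π x : M, TangentSpace I x) : d% (fun y ↦ g.form y ((f • X) y) (W y)) x
        = d% (fun y ↦ f y * g.form y (X y) (W y)) x := by
      congr 1; funext y; simp
    simp only [koszul, e]
    simp [mvfderiv_fun_mul hf (g.mdifferentiableAt_form hX hZ),
      mvfderiv_fun_mul hf (g.mdifferentiableAt_form hX hY),
      mlieBracket_smul_left hf hX]
    ring
  add {X X'} hX hX' := by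
    have e (W : Π x : M, TangentSpace I x) : d% (fun y ↦ g.form y ((X + X') y) (W y)) x
        = d% (fun y ↦ g.form y (X y) (W y) + g.form y (X' y) (W y)) x := by
      congr 1; funext y; simp
    simp only [koszul, e]
    simp [mvfderiv_fun_add (g.mdifferentiableAt_form hX hZ) (g.mdifferentiableAt_form hX' hZ),
      mvfderiv_fun_add (g.mdifferentiableAt_form hX hY) (g.mdifferentiableAt_form hX' hY),
      mlieBracket_add_left hX hX']
    ring

theorem tensorialAt_koszul_right {X Y : Π x : M, TangentSpace I x} {x : M}
    (hX : MDiffAt (T% X) x) (hY : MDiffAt (T% Y) x) :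
    TensorialAt I E (fun Z ↦ g.koszul X Y Z x) x where
  smul {f Z} hf hZ := by
    have e (W : Π x : M, TangentSpace I x) : d% (fun y ↦ g.form y (W y) ((f • Z) y)) x
        = d% (fun y ↦ f y * g.form y (W y) (Z y)) x := by
      congr 1; funext y; simp
    simp only [koszul, e]
    simp [mvfderiv_fun_mul hf (g.mdifferentiableAt_form hX hZ),
      mvfderiv_fun_mul hf (g.mdifferentiableAt_form hY hZ),
      mlieBracket_smul_right hf hZ, g.symm x (Z x)]
    ring
  add {Z Z'} hZ hZ' := by
    have e (W : Π x : M, TangentSpace I x) : d% (fun y ↦ g.form y (W y) ((Z + Z') y)) x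
        = d% (fun y ↦ g.form y (W y) (Z y) + g.form y (W y) (Z' y)) x := by
      congr 1; funext y; simp
    simp only [koszul, e]
    simp [mvfderiv_fun_add (g.mdifferentiableAt_form hX hZ) (g.mdifferentiableAt_form hX hZ'),
      mvfderiv_fun_add (g.mdifferentiableAt_form hY hZ) (g.mdifferentiableAt_form hY hZ'),
      mlieBracket_add_right hZ hZ']
    ring

open Classical in
/-- The vector `(∇_v Y)_x`, determined by the Koszul formula
`2 g(∇_X Y, Z) = koszul X Y Z` (with value `0` where `Y` is not differentiable). -/
def leviCivitaFun (Y : Π x : M, TangentSpace I x) (x : M) :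
    TangentSpace I x →L[ℝ] TangentSpace I x :=
  haveI : FiniteDimensional ℝ (TangentSpace I x) := inferInstanceAs (FiniteDimensional ℝ E)
  haveI : T2Space (TangentSpace I x) := inferInstanceAs (T2Space E)
  if hY : MDiffAt (T% Y) x then
    LinearMap.toContinuousLinearMap <| (2⁻¹ : ℝ) • (g.flat x).symm.toLinearMap ∘ₗ
      (TensorialAt.mkHom₂ (fun X Z ↦ g.koszul X Y Z x) x
        (fun _ hZ ↦ g.tensorialAt_koszul_left hY hZ)
        (fun _ hX ↦ g.tensorialAt_koszul_right hX hY)).toLinearMap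
  else 0

theorem form_leviCivitaFun {X Y Z : Π x : M, TangentSpace I x} {x : M}
    (hX : MDiffAt (T% X) x) (hY : MDiffAt (T% Y) x) (hZ : MDiffAt (T% Z) x) :
    g.form x (g.leviCivitaFun Y x (X x)) (Z x) = 2⁻¹ * g.koszul X Y Z x := by
  have h1 := fun (W : Π x : M, TangentSpace I x) (hW : MDiffAt (T% W) x) ↦
    g.tensorialAt_koszul_left (Y := Y) (Z := W) hY hW
  have h2 := fun (W : Π x : M, TangentSpace I x) (hW : MDiffAt (T% W) x) ↦
    g.tensorialAt_koszul_right (X := W) (Y := Y) hW hY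
  rw [← TensorialAt.mkHom₂_apply (Φ := fun X Z ↦ g.koszul X Y Z x) h1 h2 hX hZ]
  simp [leviCivitaFun, hY, form_flat_symm]

/-- The Levi-Civita connection of a semi-Riemannian metric; `g.leviCivita Y x (X x)` is
`(∇_X Y)_x`. -/
def leviCivita : CovariantDerivative I E (TangentSpace I : M → Type _) where
  toFun := g.leviCivitaFun
  isCovariantDerivativeOnUniv :=
    { add := by
        intro Y Y' x hY hY' _
        ext v
        refine g.ext_form fun Z hZ ↦ ?_
        have hX : MDiffAt (T% (extend E v)) x := mdifferentiableAt_extend ..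
        rw [← extend_apply_self (F := E) v]
        have e1 (W : Π x : M, TangentSpace I x) : d% (fun y ↦ g.form y (W y) ((Y + Y') y)) x
            = d% (fun y ↦ g.form y (W y) (Y y) + g.form y (W y) (Y' y)) x := by
          congr 1; funext y; simp
        have e2 (W : Π x : M, TangentSpace I x) : d% (fun y ↦ g.form y ((Y + Y') y) (W y)) x
            = d% (fun y ↦ g.form y (Y y) (W y) + g.form y (Y' y) (W y)) x := by
          congr 1; funext y; simp
        simp only [add_apply, map_add]
        rw [g.form_leviCivitaFun hX (mdifferentiableAt_add_section hY hY') hZ,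
          g.form_leviCivitaFun hX hY hZ, g.form_leviCivitaFun hX hY' hZ]
        simp only [koszul, e1, e2]
        simp [mvfderiv_fun_add (g.mdifferentiableAt_form hY hZ) (g.mdifferentiableAt_form hY' hZ),
          mvfderiv_fun_add (g.mdifferentiableAt_form hX hY) (g.mdifferentiableAt_form hX hY'),
          mlieBracket_add_left hY hY', mlieBracket_add_right hY hY']
        ring
      leibniz := by
        intro Y f x hY hf _
        ext v
        refine g.ext_form fun Z hZ ↦ ?_
        have hX : MDiffAt (T% (extend E v)) x := mdifferentiableAt_extend ..
        rw [← extend_apply_self (F := E) v]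
        have e1 (W : Π x : M, TangentSpace I x) : d% (fun y ↦ g.form y (W y) ((f • Y) y)) x
            = d% (fun y ↦ f y * g.form y (W y) (Y y)) x := by
          congr 1; funext y; simp
        have e2 (W : Π x : M, TangentSpace I x) : d% (fun y ↦ g.form y ((f • Y) y) (W y)) x
            = d% (fun y ↦ f y * g.form y (Y y) (W y)) x := by
          congr 1; funext y; simp
        simp only [add_apply, map_add, smul_apply, map_smul,
          ContinuousLinearMap.smulRight_apply, smul_eq_mul]
        rw [g.form_leviCivitaFun hX (hf.smul_section hY) hZ, g.form_leviCivitaFun hX hY hZ]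
        simp only [koszul, e1, e2]
        simp [mvfderiv_fun_mul hf (g.mdifferentiableAt_form hY hZ),
          mvfderiv_fun_mul hf (g.mdifferentiableAt_form hX hY),
          mlieBracket_smul_left hf hY, mlieBracket_smul_right hf hY]
        rw [g.symm x (Y x) v]
        ring }

theorem leviCivita_torsion : (g.leviCivita).torsion = 0 := by
  rw [CovariantDerivative.torsion_eq_zero_iff]
  intro X Y x hX hY
  refine g.ext_form fun Z hZ ↦ ?_
  simp only [map_sub, sub_apply]
  have h1 := g.form_leviCivitaFun hX hY hZ
  have h2 := g.form_leviCivitaFun hY hX hZ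
  simp only [leviCivita]
  rw [h1, h2]
  have e : (fun y ↦ g.form y (X y) (Y y)) = (fun y ↦ g.form y (Y y) (X y)) :=
    funext fun y ↦ g.symm y _ _
  simp only [koszul, e, mlieBracket_swap_apply (V := Y) (W := X)]
  simp
  ring

theorem leviCivita_metric {X Y Z : Π x : M, TangentSpace I x} {x : M}
    (hX : MDiffAt (T% X) x) (hY : MDiffAt (T% Y) x) (hZ : MDiffAt (T% Z) x) :
    d% (fun y ↦ g.form y (Y y) (Z y)) x (X x) =
      g.form x (g.leviCivita Y x (X x)) (Z x) + g.form x (Y x) (g.leviCivita Z x (X x)) := by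
  have h1 := g.form_leviCivitaFun hX hY hZ
  have h2 := g.form_leviCivitaFun hX hZ hY
  simp only [leviCivita]
  rw [g.symm x (Y x), h1, h2]
  have e : (fun y ↦ g.form y (Z y) (Y y)) = (fun y ↦ g.form y (Y y) (Z y)) :=
    funext fun y ↦ g.symm y _ _
  simp only [koszul, e, mlieBracket_swap_apply (V := Z) (W := Y)]
  simp
  ring


/-- The Hessian of `F`: the `(0,2)`-tensor `Hess(F)(X,Y) = X(Y F) - (∇_X Y) F`. -/
def hessian {F : M → ℝ} (hF : ContMDiff I 𝓘(ℝ) ∞ F) (x : M) :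
    TangentSpace I x →L[ℝ] TangentSpace I x →L[ℝ] ℝ :=
  TensorialAt.mkHom₂ (I := I) (F := E) (F' := E)
    (fun X Y ↦ d% (fun y ↦ d% F y (Y y)) x (X x) - d% F x (g.leviCivita Y x (X x))) x
    (fun Y _ ↦
      { smul := by intros; simp [mul_sub]
        add := by intros; simp; ring })
    (fun X _ ↦
      { smul := by
          intro f Y hf hY
          have e : d% (fun y ↦ d% F y ((f • Y) y)) x = d% (fun y ↦ f y * d% F y (Y y)) x := by
            congr 1; funext y; simp
          simp only [e]
          rw [mvfderiv_fun_mul hf (mdifferentiableAt_mvfderiv_apply hF hY),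
            g.leviCivita.isCovariantDerivativeOnUniv.leibniz hY hf]
          simp
          ring
        add := by
          intro Y Y' hY hY'
          have e : d% (fun y ↦ d% F y ((Y + Y') y)) x
              = d% (fun y ↦ d% F y (Y y) + d% F y (Y' y)) x := by
            congr 1; funext y; simp
          simp only [e]
          rw [mvfderiv_fun_add (mdifferentiableAt_mvfderiv_apply hF hY)
            (mdifferentiableAt_mvfderiv_apply hF hY'),
            g.leviCivita.isCovariantDerivativeOnUniv.add hY hY']
          simp
          ring })

theorem hessian_apply {F : M → ℝ} (hF : ContMDiff I 𝓘(ℝ) ∞ F) {X Y : Π x : M, TangentSpace I x}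
    {x : M} (hX : MDiffAt (T% X) x) (hY : MDiffAt (T% Y) x) :
    g.hessian hF x (X x) (Y x) =
      d% (fun y ↦ d% F y (Y y)) x (X x) - d% F x (g.leviCivita Y x (X x)) :=
  TensorialAt.mkHom₂_apply _ _ hX hY

end SemiRiemannianMetric

/-- The field of bilinear forms `-dτ ⊗ dτ + p^* b` on `N`, for `τ : N → ℝ` and `p : N → M`. -/
def stationaryForm {E : Type*} [NormedAddCommGroup E] [NormedSpace ℝ E]
    {H : Type*} [TopologicalSpace H] (I : ModelWithCorners ℝ E H)
    {M : Type*} [TopologicalSpace M] [ChartedSpace H M]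
    {E' : Type*} [NormedAddCommGroup E'] [NormedSpace ℝ E']
    {H' : Type*} [TopologicalSpace H'] (J : ModelWithCorners ℝ E' H')
    {N : Type*} [TopologicalSpace N] [ChartedSpace H' N] (τ : N → ℝ) (p : N → M)
    (b : Π x : M, TangentSpace I x →L[ℝ] TangentSpace I x →L[ℝ] ℝ) (q : N) :
    TangentSpace J q →L[ℝ] TangentSpace J q →L[ℝ] ℝ :=
  -(mvfderiv J τ q).smulRight (mvfderiv J τ q) + pullbackForm I J p b q

theorem contMDiff_stationaryForm {E : Type*} [NormedAddCommGroup E] [NormedSpace ℝ E]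
    {H : Type*} [TopologicalSpace H] {I : ModelWithCorners ℝ E H}
    {M : Type*} [TopologicalSpace M] [ChartedSpace H M] [IsManifold I ∞ M]
    {E' : Type*} [NormedAddCommGroup E'] [NormedSpace ℝ E']
    {H' : Type*} [TopologicalSpace H'] {J : ModelWithCorners ℝ E' H'}
    {N : Type*} [TopologicalSpace N] [ChartedSpace H' N] [IsManifold J ∞ N]
    {τ : N → ℝ} {p : N → M}
    {b : Π x : M, TangentSpace I x →L[ℝ] TangentSpace I x →L[ℝ] ℝ}
    (hτ : ContMDiff J 𝓘(ℝ) ∞ τ) (hp : ContMDiff J I ∞ p)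
    (hb : ContMDiff I (I.prod 𝓘(ℝ, E →L[ℝ] E →L[ℝ] ℝ)) ∞
      (fun x : M ↦ TotalSpace.mk' (E →L[ℝ] E →L[ℝ] ℝ)
        (E := fun x : M ↦ TangentSpace I x →L[ℝ] TangentSpace I x →L[ℝ] ℝ) x (b x))) :
    ContMDiff J (J.prod 𝓘(ℝ, E' →L[ℝ] E' →L[ℝ] ℝ)) ∞
      (fun q : N ↦ TotalSpace.mk' (E' →L[ℝ] E' →L[ℝ] ℝ)
        (E := fun q : N ↦ TangentSpace J q →L[ℝ] TangentSpace J q →L[ℝ] ℝ) q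
        (stationaryForm I J τ p b q)) := by
  have h1 := contMDiff_pullbackForm hτ ((riemannianMetricVectorSpace ℝ).contMDiff.of_le le_top)
  have e : ∀ q, (mvfderiv J τ q).smulRight (mvfderiv J τ q) =
      pullbackForm 𝓘(ℝ) J τ (riemannianMetricVectorSpace ℝ).inner q := by
    intro q
    ext v w
    exact mul_comm (mvfderiv J τ q v) (mvfderiv J τ q w)
  simp only [stationaryForm, e]
  exact ContMDiff.add_section (ContMDiff.neg_section h1) (contMDiff_pullbackForm hp hb)

theorem stationaryForm_fst_snd {E : Type*} [NormedAddCommGroup E] [NormedSpace ℝ E]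
    {H : Type*} [TopologicalSpace H] {I : ModelWithCorners ℝ E H}
    {M : Type*} [TopologicalSpace M] [ChartedSpace H M]
    (b : Π x : M, TangentSpace I x →L[ℝ] TangentSpace I x →L[ℝ] ℝ) (q : ℝ × M) (v w : ℝ × E) :
    stationaryForm I (𝓘(ℝ, ℝ).prod I) Prod.fst Prod.snd b q v w =
      -(v.1 * w.1) + b q.2 v.2 w.2 := by
  simp only [stationaryForm, pullbackForm, mvfderiv, mfderiv_fst, mfderiv_snd]
  rfl

/-- The metric `-dx⁰ ⊗ dx⁰ + π^* g` on `ℝ × M`. -/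
def ambientMetric {E : Type*} [NormedAddCommGroup E] [NormedSpace ℝ E]
    {H : Type*} [TopologicalSpace H] {I : ModelWithCorners ℝ E H}
    {M : Type*} [TopologicalSpace M] [ChartedSpace H M] [IsManifold I ∞ M]
    (g : SemiRiemannianMetric I M) : SemiRiemannianMetric (𝓘(ℝ, ℝ).prod I) (ℝ × M) where
  form := stationaryForm I (𝓘(ℝ, ℝ).prod I) Prod.fst Prod.snd g.form
  symm q v w := by
    erw [stationaryForm_fst_snd g.form q v w, stationaryForm_fst_snd g.form q w v]
    exact congrArg₂ (· + ·) (congrArg _ (mul_comm _ _)) (g.symm q.2 v.2 w.2)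
  nondegenerate q v h := by
    have h1 := h ((1, 0) : ℝ × E)
    erw [stationaryForm_fst_snd g.form q v] at h1
    have h2 : v.2 = 0 := g.nondegenerate q.2 v.2 fun w ↦ by
      have := h ((0, w) : ℝ × E)
      erw [stationaryForm_fst_snd g.form q v] at this
      simpa using this
    have h3 : g.form q.2 v.2 0 = 0 := map_zero _
    have h4 : v.1 = 0 := by
      have : -(v.1 * (1 : ℝ)) + g.form q.2 v.2 0 = 0 := h1
      rw [h3] at this
      linarith
    exact Prod.ext h4 h2
  contMDiff := contMDiff_stationaryForm contMDiff_fst contMDiff_snd g.contMDiff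

/-- The vectors of `T_q N` that are tangent to the subset `S` at `q`: the velocities at time `0` of
smooth curves that start at `q` and stay in `S`.  For an embedded submanifold `S` this is the
tangent space `T_q S`, seen inside `T_q N`. -/
def tangentVectors {E : Type*} [NormedAddCommGroup E] [NormedSpace ℝ E]
    {H : Type*} [TopologicalSpace H] (I : ModelWithCorners ℝ E H)
    {N : Type*} [TopologicalSpace N] [ChartedSpace H N] (S : Set N) (q : N) :
    Set (TangentSpace I q) :=
  {v | ∃ γ : ℝ → N, ContMDiffAt 𝓘(ℝ, ℝ) I ∞ γ 0 ∧ (∀ᶠ t in 𝓝 (0 : ℝ), γ t ∈ S) ∧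
    tangentMap 𝓘(ℝ, ℝ) I γ (⟨0, (1 : ℝ)⟩ : TangentBundle 𝓘(ℝ, ℝ) ℝ) = ⟨q, v⟩}

namespace SemiRiemannianMetric

variable {E : Type*} [NormedAddCommGroup E] [NormedSpace ℝ E] [FiniteDimensional ℝ E]
  {H : Type*} [TopologicalSpace H] {I : ModelWithCorners ℝ E H}
  {N : Type*} [TopologicalSpace N] [ChartedSpace H N] [IsManifold I ∞ N]
  (g : SemiRiemannianMetric I N)

/-- `B_ξ(X, Y) = g(∇_X Y, ξ)` at the point `q`, where `∇` is the Levi-Civita connection of the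
ambient metric `g`. For `q` in a hypersurface `S`, `ξ` normal to `S` and `X`, `Y` tangent to `S`
along `S`, this is the second fundamental form of `S` with respect to `ξ`. -/
def secondFundamentalForm (ξ X Y : Π q : N, TangentSpace I q) (q : N) : ℝ :=
  g.form q (g.leviCivita Y q (X q)) (ξ q)

/-- A hypersurface `S` of `(N, g)` is totally umbilical if, locally around each of its points,
there are a nowhere vanishing smooth normal section `ξ` and a smooth function `ρ` such that
`B_ξ(X, Y) = ρ g(X, Y)` on `S` for all smooth local vector fields `X`, `Y` tangent to `S`.
Smooth local sections and functions on `S` are given by smooth extensions to open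
subsets of `N`. -/
def IsTotallyUmbilical (S : Set N) : Prop :=
  ∀ q ∈ S, ∃ V : Set N, IsOpen V ∧ q ∈ V ∧
    ∃ ξ : Π y : N, TangentSpace I y, CMDiff[V] ∞ (T% ξ) ∧
      (∀ y ∈ S ∩ V, ξ y ≠ 0 ∧ ∀ v ∈ tangentVectors I S y, g.form y (ξ y) v = 0) ∧
      ∃ ρ : N → ℝ, CMDiff[V] ∞ ρ ∧
        ∀ W : Set N, IsOpen W → W ⊆ V →
          ∀ X Y : Π y : N, TangentSpace I y, CMDiff[W] ∞ (T% X) → CMDiff[W] ∞ (T% Y) →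
            (∀ y ∈ S ∩ W, X y ∈ tangentVectors I S y ∧ Y y ∈ tangentVectors I S y) →
              ∀ y ∈ S ∩ W,
                g.secondFundamentalForm ξ X Y y = ρ y * g.form y (X y) (Y y)

end SemiRiemannianMetric

/-- The Monge-type hypersurface `{(t, p) | t = F(p)}` in `ℝ × M`. -/
def mongeHypersurface {M : Type*} (F : M → ℝ) : Set (ℝ × M) :=
  {q | q.1 = F q.2}

end

noncomputable section

open Bundle FiberBundle VectorField Set

section CoordinateFields

variable {E : Type*} [NormedAddCommGroup E] [NormedSpace ℝ E]
  {H : Type*} [TopologicalSpace H] {I : ModelWithCorners ℝ E H}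
  {M : Type*} [TopologicalSpace M] [ChartedSpace H M] [IsManifold I ∞ M]

/-- Two vector fields with constant coordinates in a chart around `x` commute at `x`. -/
theorem mlieBracket_eq_zero_of_mfderiv_extChartAt_const {V W : Π y : M, TangentSpace I y} {x : M}
    {c d : E}
    (hV : ∀ y ∈ (chartAt H x).source, mfderiv I 𝓘(ℝ, E) (extChartAt I x) y (V y) = c)
    (hW : ∀ y ∈ (chartAt H x).source, mfderiv I 𝓘(ℝ, E) (extChartAt I x) y (W y) = d) :
    mlieBracket I V W x = 0 := by
  have key (V : Π y : M, TangentSpace I y) (c : E)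
      (hV : ∀ y ∈ (chartAt H x).source, mfderiv I 𝓘(ℝ, E) (extChartAt I x) y (V y) = c) :
      ∀ y ∈ (extChartAt I x).target,
        mpullbackWithin 𝓘(ℝ, E) I (extChartAt I x).symm V (range I) y = c := by
    intro y hy
    have hy' : (extChartAt I x).symm y ∈ (chartAt H x).source := by
      simpa using (extChartAt I x).map_target hy
    rw [mpullbackWithin_apply, ContinuousLinearMap.inverse_eq
      (mfderivWithin_extChartAt_symm_comp_mfderiv_extChartAt hy)
      (mfderiv_extChartAt_comp_mfderivWithin_extChartAt_symm hy)]
    exact hV _ hy'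
  have hc := key V c hV
  have hd := key W d hW
  have hx := mem_extChartAt_target (I := I) x
  have hev (u : E) (V : E → E) (hV : ∀ y ∈ (extChartAt I x).target, V y = u) :
      V =ᶠ[𝓝[range I] (extChartAt I x x)] fun _ ↦ u := by
    filter_upwards [extChartAt_target_mem_nhdsWithin (I := I) x] with y hy using hV y hy
  rw [mlieBracket, mlieBracketWithin_apply]
  simp only [preimage_univ, univ_inter]
  have : lieBracketWithin ℝ (mpullbackWithin 𝓘(ℝ, E) I (extChartAt I x).symm V (range I))
      (mpullbackWithin 𝓘(ℝ, E) I (extChartAt I x).symm W (range I)) (range I)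
      (extChartAt I x x) = 0 := by
    rw [Filter.EventuallyEq.lieBracketWithin_vectorField_eq (hev c _ hc) (hc _ hx)
      (hev d _ hd) (hd _ hx)]
    simp [lieBracketWithin_eq]
  erw [this]
  exact map_zero (mfderiv I 𝓘(ℝ, E) (extChartAt I x) x).inverse

/-- In the chart at `x`, the field `extend E v` is the constant field `v`. -/
theorem mfderiv_extChartAt_extend {x : M} (v : TangentSpace I x) {y : M}
    (hy : y ∈ (chartAt H x).source) :
    mfderiv I 𝓘(ℝ, E) (extChartAt I x) y (extend E v y) = v := by
  have hy' : y ∈ (trivializationAt E (TangentSpace I) x).baseSet := hy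
  have hx' : x ∈ (trivializationAt E (TangentSpace I) x).baseSet := mem_chart_source H x
  have h := TangentBundle.continuousLinearMapAt_trivializationAt (I := I) hy
  have h0 := TangentBundle.continuousLinearMapAt_trivializationAt (I := I) (mem_chart_source H x)
  rw [mfderiv_extChartAt_self] at h0
  have h1 : (trivializationAt E (TangentSpace I) x).continuousLinearMapAt ℝ y (extend E v y) =
      (trivializationAt E (TangentSpace I) x).continuousLinearMapAt ℝ x v := by
    rw [extend, ← Trivialization.symmL_apply (R := ℝ) _ hy',
      Trivialization.continuousLinearMapAt_symmL _ hy', Trivialization.continuousLinearMapAt_apply,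
      Trivialization.linearMapAt_apply, if_pos hx']
  exact (congrArg (fun L ↦ L (extend E v y)) h).symm.trans
    (h1.trans (congrArg (fun L ↦ L v) h0))

theorem contMDiffOn_extend {x : M} (v : TangentSpace I x) :
    ContMDiffOn I (I.prod 𝓘(ℝ, E)) ∞
      (fun y ↦ TotalSpace.mk' E (E := (TangentSpace I : M → Type _)) y (extend E v y))
      (chartAt H x).source := by
  intro y hy
  have hy' : y ∈ (trivializationAt E (TangentSpace I) x).baseSet := hy
  rw [(trivializationAt E (TangentSpace I) x).contMDiffWithinAt_section _ hy']
  refine (contMDiffWithinAt_const (c := (trivializationAt E (TangentSpace I) x ⟨x, v⟩).2)).congr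
    (fun z hz ↦ ?_) ?_
  · have hz' : z ∈ (trivializationAt E (TangentSpace I) x).baseSet := hz
    simp [extend, -TangentBundle.trivializationAt_baseSet, hz']
  · simp [extend, -TangentBundle.trivializationAt_baseSet, hy']

end CoordinateFields

section LiftField

variable {E : Type*} [NormedAddCommGroup E] [NormedSpace ℝ E]
  {M : Type*} [TopologicalSpace M] [ChartedSpace E M] [IsManifold 𝓘(ℝ, E) ∞ M]

/-- The vector field `a ∂₀ + V` on `ℝ × M`, for a function `a` on `ℝ × M` and a vector field `V`
on `M`. -/
def liftField (a : ℝ × M → ℝ) (V : Π x : M, TangentSpace 𝓘(ℝ, E) x) (q : ℝ × M) :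
    TangentSpace (𝓘(ℝ, ℝ).prod 𝓘(ℝ, E)) q :=
  ((a q, V q.2) : ℝ × E)

theorem ContMDiffWithinAt.liftField {a : ℝ × M → ℝ} {V : Π x : M, TangentSpace 𝓘(ℝ, E) x}
    {W : Set (ℝ × M)} {U : Set M} {q : ℝ × M} (hU : MapsTo Prod.snd W U)
    (ha : ContMDiffWithinAt (𝓘(ℝ, ℝ).prod 𝓘(ℝ, E)) 𝓘(ℝ) ∞ a W q)
    (hV : CMDiffAt[U] ∞ (T% V) q.2) : CMDiffAt[W] ∞ (T% (liftField a V)) q := by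
  have h1 : ContMDiffWithinAt (𝓘(ℝ, ℝ).prod 𝓘(ℝ, E)) (𝓘(ℝ, ℝ).prod 𝓘(ℝ, ℝ)) ∞
      (fun q : ℝ × M ↦ (⟨q.1, a q⟩ : TangentBundle 𝓘(ℝ, ℝ) ℝ)) W q :=
    contMDiffWithinAt_totalSpace.2 ⟨contMDiffWithinAt_fst, by simpa using ha⟩
  have h2 : ContMDiffWithinAt (𝓘(ℝ, ℝ).prod 𝓘(ℝ, E)) (𝓘(ℝ, E).prod 𝓘(ℝ, E)) ∞
      (fun q : ℝ × M ↦ (⟨q.2, V q.2⟩ : TangentBundle 𝓘(ℝ, E) M)) W q :=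
    hV.comp q contMDiffWithinAt_snd hU
  exact (contMDiff_equivTangentBundleProd_symm (n := ∞) |>.contMDiffAt).comp_contMDiffWithinAt q
    (h1.prodMk h2)

theorem mdifferentiableAt_liftField_const (b : ℝ) {x : M} (w : TangentSpace 𝓘(ℝ, E) x) (t : ℝ) :
    MDiffAt (T% (liftField (fun _ ↦ b) (extend E w))) (t, x) := by
  have : CMDiffAt[univ] ∞ (T% (liftField (fun _ ↦ b) (extend E w))) (t, x) :=
    ContMDiffWithinAt.liftField (mapsTo_univ _ univ) contMDiffWithinAt_const
      (contMDiffAt_extend (k := ∞) 𝓘(ℝ, E) E w).contMDiffWithinAt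
  exact (contMDiffWithinAt_univ.1 this).mdifferentiableAt (by simp)

theorem mlieBracket_liftField_const (a b : ℝ) {x : M} (v w : TangentSpace 𝓘(ℝ, E) x) (t : ℝ) :
    mlieBracket (𝓘(ℝ, ℝ).prod 𝓘(ℝ, E)) (liftField (fun _ ↦ a) (extend E v))
      (liftField (fun _ ↦ b) (extend E w)) (t, x) = 0 := by
  have key (a : ℝ) (v : TangentSpace 𝓘(ℝ, E) x) : ∀ y ∈ (chartAt (ModelProd ℝ E) (t, x)).source,
      mfderiv (𝓘(ℝ, ℝ).prod 𝓘(ℝ, E)) 𝓘(ℝ, ℝ × E) (extChartAt (𝓘(ℝ, ℝ).prod 𝓘(ℝ, E)) (t, x)) y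
        (liftField (fun _ ↦ a) (extend E v) y) = ((a, v) : ℝ × E) := by
    intro y hy
    have hy2 : y.2 ∈ (chartAt E x).source := by
      have : y.1 ∈ (chartAt ℝ t).source ∧ y.2 ∈ (chartAt E x).source := by simpa using hy
      exact this.2
    have e : (extChartAt (𝓘(ℝ, ℝ).prod 𝓘(ℝ, E)) (t, x) : ℝ × M → ℝ × E)
        = Prod.map id (extChartAt 𝓘(ℝ, E) x) := by
      rw [extChartAt_prod]; rfl
    have h := mfderiv_extChartAt_extend v hy2
    rw [e]
    have h3 := mfderiv_prodMap (p := y) (f := (id : ℝ → ℝ)) (g := extChartAt 𝓘(ℝ, E) x)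
      (I := 𝓘(ℝ, ℝ)) (J := 𝓘(ℝ, ℝ)) (I' := 𝓘(ℝ, E)) (J' := 𝓘(ℝ, E)) mdifferentiableAt_id
      (mdifferentiableAt_extChartAt hy2)
    rw [mfderiv_id] at h3
    rw [modelWithCornersSelf_prod, ← chartedSpaceSelf_prod]
    exact (congrArg (fun L ↦ L ((a, extend E v y.2) : ℝ × E)) h3).trans 
      (show ((a, mfderiv 𝓘(ℝ, E) 𝓘(ℝ, E) (extChartAt 𝓘(ℝ, E) x) y.2 (extend E v y.2)) : ℝ × E) =
        (a, v) from Prod.ext rfl h)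
  exact mlieBracket_eq_zero_of_mfderiv_extChartAt_const (key a v) (key b w)

end LiftField

section AmbientMetric

variable {E : Type*} [NormedAddCommGroup E] [NormedSpace ℝ E]
  {M : Type*} [TopologicalSpace M] [ChartedSpace E M] [IsManifold 𝓘(ℝ, E) ∞ M]
  (g : SemiRiemannianMetric 𝓘(ℝ, E) M)

theorem ambientMetric_form (q : ℝ × M) (v w : ℝ × E) :
    (ambientMetric g).form q v w = -(v.1 * w.1) + g.form q.2 v.2 w.2 :=
  stationaryForm_fst_snd g.form q v w

omit [IsManifold 𝓘(ℝ, E) ∞ M] in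
/-- The derivative of a function on `ℝ × M` that does not depend on the first variable. -/
theorem mvfderiv_comp_snd {f : M → ℝ} {q : ℝ × M} (hf : MDiffAt f q.2) (v : ℝ × E) :
    mvfderiv (𝓘(ℝ, ℝ).prod 𝓘(ℝ, E)) (fun y : ℝ × M ↦ f y.2) q v =
      mvfderiv 𝓘(ℝ, E) f q.2 v.2 := by
  have h := mvfderiv_comp_apply (I := 𝓘(ℝ, E)) (I' := 𝓘(ℝ, ℝ).prod 𝓘(ℝ, E)) (g := f)
    (f := (Prod.snd : ℝ × M → M)) q hf mdifferentiableAt_snd v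
  rw [mfderiv_snd] at h
  exact h

theorem mvfderiv_ambientMetric_liftField (b c : ℝ) {x : M} (w z : TangentSpace 𝓘(ℝ, E) x) (t : ℝ)
    (v : ℝ × E) :
    mvfderiv (𝓘(ℝ, ℝ).prod 𝓘(ℝ, E)) (fun y ↦ (ambientMetric g).form y
      (liftField (fun _ ↦ b) (extend E w) y) (liftField (fun _ ↦ c) (extend E z) y)) (t, x) v =
    mvfderiv 𝓘(ℝ, E) (fun y ↦ g.form y (extend E w y) (extend E z y)) x v.2 := by
  have h : MDiffAt (fun y ↦ g.form y (extend E w y) (extend E z y)) x :=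
    g.mdifferentiableAt_form (mdifferentiableAt_extend ..) (mdifferentiableAt_extend ..)
  have e : (fun y ↦ (ambientMetric g).form y
      (liftField (fun _ ↦ b) (extend E w) y) (liftField (fun _ ↦ c) (extend E z) y)) =
      fun y : ℝ × M ↦ (fun x ↦ -(b * c) + g.form x (extend E w x) (extend E z x)) y.2 :=
    funext fun y ↦ ambientMetric_form g y _ _
  rw [e]
  refine (mvfderiv_comp_snd (q := (t, x)) (mdifferentiableAt_const.add h) v).trans ?_
  have h' := mvfderiv_fun_add (mdifferentiableAt_const (c := -(b * c))) h
  rw [mvfderiv_const, zero_add] at h'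
  exact congrArg (fun L ↦ L v.2) h'

variable [FiniteDimensional ℝ E]

theorem ambientMetric_leviCivita_liftField (a b c : ℝ) {x : M} (v w z : TangentSpace 𝓘(ℝ, E) x)
    (t : ℝ) :
    (ambientMetric g).form (t, x)
      ((ambientMetric g).leviCivita (liftField (fun _ ↦ b) (extend E w)) (t, x) ((a, v) : ℝ × E))
      ((c, z) : ℝ × E) = g.form x (g.leviCivita (extend E w) x v) z := by
  have e (a : ℝ) (v : TangentSpace 𝓘(ℝ, E) x) :
      liftField (fun _ ↦ a) (extend E v) (t, x) = ((a, v) : ℝ × E) :=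
    Prod.ext rfl (extend_apply_self ..)
  have h1 := (ambientMetric g).form_leviCivitaFun (mdifferentiableAt_liftField_const a v t)
    (mdifferentiableAt_liftField_const b w t) (mdifferentiableAt_liftField_const c z t)
  have h2 := g.form_leviCivitaFun (mdifferentiableAt_extend 𝓘(ℝ, E) E v)
    (mdifferentiableAt_extend 𝓘(ℝ, E) E w) (mdifferentiableAt_extend 𝓘(ℝ, E) E z)
  rw [e, e] at h1
  simp only [extend_apply_self] at h2
  refine h1.trans (Eq.trans ?_ h2.symm)
  congr 1
  simp only [SemiRiemannianMetric.koszul, e, mlieBracket_liftField_const,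
    mvfderiv_ambientMetric_liftField]
  rw [mlieBracket_eq_zero_of_mfderiv_extChartAt_const (fun y ↦ mfderiv_extChartAt_extend v)
      (fun y ↦ mfderiv_extChartAt_extend w),
    mlieBracket_eq_zero_of_mfderiv_extChartAt_const (fun y ↦ mfderiv_extChartAt_extend v)
      (fun y ↦ mfderiv_extChartAt_extend z),
    mlieBracket_eq_zero_of_mfderiv_extChartAt_const (fun y ↦ mfderiv_extChartAt_extend w)
      (fun y ↦ mfderiv_extChartAt_extend z)]
  simp only [map_zero]
  exact (show _ = _ + (0 : ℝ) - 0 - 0 from rfl).trans (by simp)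

end AmbientMetric

section Height

variable {E : Type*} [NormedAddCommGroup E] [NormedSpace ℝ E]
  {M : Type*} [TopologicalSpace M] [ChartedSpace E M] [IsManifold 𝓘(ℝ, E) ∞ M]
  {F : M → ℝ}

/-- The defining function `x⁰ - F` of the hypersurface `{x⁰ = F}`. -/
def heightFunction (F : M → ℝ) (q : ℝ × M) : ℝ := q.1 - F q.2

omit [IsManifold 𝓘(ℝ, E) ∞ M] in
theorem contMDiff_heightFunction (hF : ContMDiff 𝓘(ℝ, E) 𝓘(ℝ) ∞ F) :
    ContMDiff (𝓘(ℝ, ℝ).prod 𝓘(ℝ, E)) 𝓘(ℝ) ∞ (heightFunction F) :=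
  contMDiff_fst.sub (hF.comp contMDiff_snd)

omit [IsManifold 𝓘(ℝ, E) ∞ M] in
theorem mvfderiv_heightFunction (hF : ContMDiff 𝓘(ℝ, E) 𝓘(ℝ) ∞ F) (q : ℝ × M) (v : ℝ × E) :
    mvfderiv (𝓘(ℝ, ℝ).prod 𝓘(ℝ, E)) (heightFunction F) q v =
      v.1 - mvfderiv 𝓘(ℝ, E) F q.2 v.2 := by
  have h1 : MDiffAt F q.2 := hF.mdifferentiable (by simp) _
  have h2 : MDifferentiableAt (𝓘(ℝ, ℝ).prod 𝓘(ℝ, E)) 𝓘(ℝ) (fun y : ℝ × M ↦ F y.2) q :=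
    h1.comp q mdifferentiableAt_snd
  have h3 := mvfderiv_fun_sub (I := 𝓘(ℝ, ℝ).prod 𝓘(ℝ, E)) (g := (Prod.fst : ℝ × M → ℝ))
    mdifferentiableAt_fst h2
  refine (congrArg (fun L ↦ L v) h3).trans ?_
  have h4 := mvfderiv_comp_snd h1 v
  refine congrArg₂ (· - ·) ?_ h4
  rw [mvfderiv, mfderiv_fst]
  rfl

variable [FiniteDimensional ℝ E] (g : SemiRiemannianMetric 𝓘(ℝ, E) M)

/-- The gradient of `F` at `x`. -/
def SemiRiemannianMetric.gradient (F : M → ℝ) (x : M) : TangentSpace 𝓘(ℝ, E) x :=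
  (g.flat x).symm (mvfderiv 𝓘(ℝ, E) F x)

theorem SemiRiemannianMetric.form_gradient (x : M) (v : TangentSpace 𝓘(ℝ, E) x) :
    g.form x (g.gradient F x) v = mvfderiv 𝓘(ℝ, E) F x v := by
  rw [gradient, form_flat_symm]

theorem ambientMetric_form_gradient (hF : ContMDiff 𝓘(ℝ, E) 𝓘(ℝ) ∞ F) (q : ℝ × M) (v : ℝ × E) :
    (ambientMetric g).form q v ((1, g.gradient F q.2) : ℝ × E) =
      -mvfderiv (𝓘(ℝ, ℝ).prod 𝓘(ℝ, E)) (heightFunction F) q v := by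
  have h := (g.symm q.2 v.2 (g.gradient F q.2)).trans (g.form_gradient q.2 v.2)
  rw [mvfderiv_heightFunction hF, ambientMetric_form]
  linarith

theorem hessian_heightFunction_mk (hF : ContMDiff 𝓘(ℝ, E) 𝓘(ℝ) ∞ F) (t a b : ℝ) {x : M}
    (v w : TangentSpace 𝓘(ℝ, E) x) :
    (ambientMetric g).hessian (contMDiff_heightFunction hF) (t, x) ((a, v) : ℝ × E)
      ((b, w) : ℝ × E) = -g.hessian hF x v w := by
  have e (a : ℝ) (v : TangentSpace 𝓘(ℝ, E) x) :
      liftField (fun _ ↦ a) (extend E v) (t, x) = ((a, v) : ℝ × E) :=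
    Prod.ext rfl (extend_apply_self ..)
  have h1 := (ambientMetric g).hessian_apply (contMDiff_heightFunction hF)
    (mdifferentiableAt_liftField_const a (x := x) v t)
    (mdifferentiableAt_liftField_const b (x := x) w t)
  have h2 := g.hessian_apply hF (mdifferentiableAt_extend 𝓘(ℝ, E) E (x := x) v)
    (mdifferentiableAt_extend 𝓘(ℝ, E) E (x := x) w)
  simp only [extend_apply_self] at h2
  rw [e, e] at h1
  refine h1.trans (Eq.trans ?_ (congrArg Neg.neg h2).symm)
  have h3 := ambientMetric_leviCivita_liftField g a b 1 (x := x) v w (g.gradient F x) t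
  rw [g.symm, g.form_gradient] at h3
  have h4 := ambientMetric_form_gradient g hF (t, x)
    ((ambientMetric g).leviCivita (liftField (fun _ ↦ b) (extend E w)) (t, x) ((a, v) : ℝ × E))
  have h5 := h4.symm.trans h3
  have hw : MDiffAt (fun y ↦ mvfderiv 𝓘(ℝ, E) F y (extend E w y)) x :=
    SemiRiemannianMetric.mdifferentiableAt_mvfderiv_apply hF (mdifferentiableAt_extend 𝓘(ℝ, E) E w)
  have e2 : (fun y ↦ mvfderiv (𝓘(ℝ, ℝ).prod 𝓘(ℝ, E)) (heightFunction F) y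
      (liftField (fun _ ↦ b) (extend E w) y)) =
      fun y : ℝ × M ↦ (fun x ↦ b - mvfderiv 𝓘(ℝ, E) F x (extend E w x)) y.2 :=
    funext fun y ↦ mvfderiv_heightFunction hF y _
  have h6 : mvfderiv (𝓘(ℝ, ℝ).prod 𝓘(ℝ, E))
      (fun y ↦ mvfderiv (𝓘(ℝ, ℝ).prod 𝓘(ℝ, E)) (heightFunction F) y
      (liftField (fun _ ↦ b) (extend E w) y)) (t, x) ((a, v) : ℝ × E) =
      -mvfderiv 𝓘(ℝ, E) (fun y ↦ mvfderiv 𝓘(ℝ, E) F y (extend E w y)) x v := by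
    rw [e2]
    refine (mvfderiv_comp_snd (q := (t, x)) (mdifferentiableAt_const.sub hw) _).trans ?_
    have h' := mvfderiv_fun_sub (mdifferentiableAt_const (c := b)) hw
    rw [mvfderiv_const, zero_sub] at h'
    exact congrArg (fun L ↦ L v) h'
  linarith

theorem hessian_heightFunction (hF : ContMDiff 𝓘(ℝ, E) 𝓘(ℝ) ∞ F) (q : ℝ × M) (v w : ℝ × E) :
    (ambientMetric g).hessian (contMDiff_heightFunction hF) q v w =
      -g.hessian hF q.2 v.2 w.2 :=
  hessian_heightFunction_mk g hF q.1 v.1 w.1 v.2 w.2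

end Height

section Gradient

variable {E : Type*} [NormedAddCommGroup E] [NormedSpace ℝ E] [FiniteDimensional ℝ E]

theorem isInvertible_of_injective_dual {L : E →L[ℝ] E →L[ℝ] ℝ} (hL : Function.Injective L) :
    L.IsInvertible := by
  have h : Module.finrank ℝ E = Module.finrank ℝ (E →L[ℝ] ℝ) := by
    rw [← (LinearMap.toContinuousLinearMap (𝕜 := ℝ) (E := E) (F' := ℝ)).finrank_eq,
      Module.finrank_linearMap, Module.finrank_self, mul_one]
  exact ⟨(LinearMap.linearEquivOfInjective (L : E →ₗ[ℝ] (E →L[ℝ] ℝ)) hL h).toContinuousLinearEquiv,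
    by ext; rfl⟩

variable {M : Type*} [TopologicalSpace M] [ChartedSpace E M] [IsManifold 𝓘(ℝ, E) ∞ M]
  (g : SemiRiemannianMetric 𝓘(ℝ, E) M) {F : M → ℝ}

theorem SemiRiemannianMetric.contMDiff_gradient (hF : ContMDiff 𝓘(ℝ, E) 𝓘(ℝ) ∞ F) :
    CMDiff ∞ (T% (g.gradient F)) := by
  intro x₀
  rw [contMDiffAt_section]
  set e := trivializationAt E (TangentSpace 𝓘(ℝ, E)) x₀
  have hG := ((contMDiffAt_hom_bundle _).1 (g.contMDiff x₀)).2
  have hD := (hF x₀).mfderiv_const (m := ∞) (by simp)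
  have he : ∀ᶠ x in 𝓝 x₀, x ∈ e.baseSet :=
    e.open_baseSet.mem_nhds (mem_baseSet_trivializationAt ..)
  set G : M → E →L[ℝ] E →L[ℝ] ℝ := fun x ↦ ContinuousLinearMap.inCoordinates E
    (TangentSpace 𝓘(ℝ, E)) (E →L[ℝ] ℝ) (fun x : M ↦ TangentSpace 𝓘(ℝ, E) x →L[ℝ] ℝ) x₀ x x₀ x
    (g.form x) with hGdef
  have hGapp : ∀ x ∈ e.baseSet, ∀ u v : E, G x u v = g.form x (e.symm x u) (e.symm x v) := by
    intro x hx u v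
    rw [hGdef]
    dsimp only
    erw [inCoordinates_apply_eq₂ hx hx (by simp)]
    simp
    rfl
  have hinv : ∀ x ∈ e.baseSet, (G x).IsInvertible := by
    intro x hx
    refine isInvertible_of_injective_dual ((injective_iff_map_eq_zero _).2 fun u hu ↦ ?_)
    have h0 : e.symm x u = 0 := g.nondegenerate x _ fun w ↦ by
      have h1 : G x u (e ⟨x, w⟩).2 = 0 := by rw [hu]; rfl
      rw [hGapp x hx] at h1
      rwa [e.symm_apply_apply_mk hx] at h1
    have h2 := e.apply_mk_symm hx u
    rw [h0] at h2
    exact (congrArg Prod.snd h2).symm.trans (congrArg Prod.snd (e.zeroSection ℝ hx))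
  set D : M → E →L[ℝ] ℝ :=
    inTangentCoordinates 𝓘(ℝ, E) 𝓘(ℝ) id F (mfderiv 𝓘(ℝ, E) 𝓘(ℝ) F) x₀ with hDdef
  have hDapp : ∀ x ∈ e.baseSet, ∀ u : E, D x u = mvfderiv 𝓘(ℝ, E) F x (e.symm x u) := by
    intro x hx u
    simp [hDdef, inTangentCoordinates, ContinuousLinearMap.inCoordinates]
    exact congrArg (mvfderiv 𝓘(ℝ, E) F x) (Trivialization.symmL_apply (R := ℝ) e hx u)
  have hx₀ : x₀ ∈ e.baseSet := mem_baseSet_trivializationAt ..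
  have hmain : ContMDiffAt 𝓘(ℝ, E) 𝓘(ℝ, E) ∞ (fun x ↦ (G x).inverse (D x)) x₀ := by
    have h1 : ContMDiffAt 𝓘(ℝ, E) 𝓘(ℝ, (E →L[ℝ] ℝ) →L[ℝ] E) ∞ (fun x ↦ (G x).inverse) x₀ :=
      ContMDiffAt.comp x₀ (hinv x₀ hx₀).contDiffAt_map_inverse.contMDiffAt hG
    exact h1.clm_apply hD
  refine hmain.congr_of_eventuallyEq ?_
  filter_upwards [he] with x hx
  rw [← (hinv x hx).inverse_apply_self (e ⟨x, g.gradient F x⟩).2]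
  congr 1
  ext u
  rw [hGapp x hx, hDapp x hx, e.symm_apply_apply_mk hx, g.form_gradient]

end Gradient

section Tangent

variable {E : Type*} [NormedAddCommGroup E] [NormedSpace ℝ E]
  {H : Type*} [TopologicalSpace H] {I : ModelWithCorners ℝ E H}
  {N : Type*} [TopologicalSpace N] [ChartedSpace H N]

theorem mvfderiv_eq_zero_of_mem_tangentVectors {S : Set N} {q : N} {v : TangentSpace I q}
    (hv : v ∈ tangentVectors I S q) {f : N → ℝ} (hf : MDiffAt f q)
    (h0 : ∀ᶠ y in 𝓝 q, y ∈ S → f y = 0) : mvfderiv I f q v = 0 := by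
  obtain ⟨γ, hγ, hS, hv⟩ := hv
  obtain rfl : γ 0 = q := congrArg TotalSpace.proj hv
  have hv' : mfderiv 𝓘(ℝ, ℝ) I γ 0 (1 : ℝ) = v := eq_of_heq (TotalSpace.mk.inj hv).2
  have h1 := mvfderiv_comp_apply (I := I) (I' := 𝓘(ℝ, ℝ)) (0 : ℝ) hf
    (hγ.mdifferentiableAt (by simp)) (1 : ℝ)
  have h2 : f ∘ γ =ᶠ[𝓝 0] fun _ ↦ (0 : ℝ) := by
    filter_upwards [hS, hγ.continuousAt.eventually h0] with t h h' using h' h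
  rw [hv'] at h1
  rw [← h1, mvfderiv, h2.mfderiv_eq, mfderiv_const]
  rfl

end Tangent

section Monge

variable {E : Type*} [NormedAddCommGroup E] [NormedSpace ℝ E]
  {M : Type*} [TopologicalSpace M] [ChartedSpace E M] [IsManifold 𝓘(ℝ, E) ∞ M]
  {F : M → ℝ}

/-- Every tangent vector of a manifold without boundary is the velocity of a smooth curve. -/
theorem exists_contMDiffAt_tangentMap_eq (x : M) (w : E) :
    ∃ c : ℝ → M, ContMDiffAt 𝓘(ℝ, ℝ) 𝓘(ℝ, E) ∞ c 0 ∧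
      tangentMap 𝓘(ℝ, ℝ) 𝓘(ℝ, E) c (⟨0, (1 : ℝ)⟩ : TangentBundle 𝓘(ℝ, ℝ) ℝ) =
        (⟨x, w⟩ : TangentBundle 𝓘(ℝ, E) M) := by
  set φ := extChartAt 𝓘(ℝ, E) x
  have hl : ContMDiff 𝓘(ℝ, ℝ) 𝓘(ℝ, E) ∞ (fun t : ℝ ↦ φ x + t • w) :=
    (contDiff_const.add (contDiff_id.smul contDiff_const)).contMDiff
  have hl0 : φ x + (0 : ℝ) • w = φ x := by simp
  have hs : ContMDiffAt 𝓘(ℝ, E) 𝓘(ℝ, E) ∞ φ.symm (φ x) :=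
    (contMDiffOn_extChartAt_symm x).contMDiffAt (extChartAt_target_mem_nhds x)
  have hs' : ContMDiffAt 𝓘(ℝ, E) 𝓘(ℝ, E) ∞ φ.symm (φ x + (0 : ℝ) • w) := by rwa [hl0]
  refine ⟨φ.symm ∘ fun t : ℝ ↦ φ x + t • w, hs'.comp (0 : ℝ) hl.contMDiffAt, ?_⟩
  rw [tangentMap_comp_at _ (hs'.mdifferentiableAt (by simp)) (hl.mdifferentiable (by simp) _)]
  have h1 : tangentMap 𝓘(ℝ, ℝ) 𝓘(ℝ, E) (fun t : ℝ ↦ φ x + t • w)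
      (⟨0, (1 : ℝ)⟩ : TangentBundle 𝓘(ℝ, ℝ) ℝ) = (⟨φ x, w⟩ : TangentBundle 𝓘(ℝ, E) E) := by
    refine congrArg₂ (fun y u : E ↦ (⟨y, u⟩ : TangentBundle 𝓘(ℝ, E) E)) hl0 ?_
    rw [mfderiv_eq_fderiv]
    have : HasDerivAt (fun t : ℝ ↦ φ x + t • w) ((1 : ℝ) • w) 0 :=
      ((hasDerivAt_id (0 : ℝ)).smul_const w).const_add _
    exact (this.deriv).trans (one_smul ..)
  rw [h1]
  refine congrArg₂ (fun (y : M) (u : E) ↦ (⟨y, u⟩ : TangentBundle 𝓘(ℝ, E) M))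
    (extChartAt_to_inv (I := 𝓘(ℝ, E)) x) ?_
  have h2 := mfderivWithin_range_extChartAt_symm (I := 𝓘(ℝ, E)) (x := x)
  rw [modelWithCornersSelf_coe, range_id, mfderivWithin_univ] at h2
  exact congrArg (fun L ↦ L w) h2

theorem mem_tangentVectors_mongeHypersurface (hF : ContMDiff 𝓘(ℝ, E) 𝓘(ℝ) ∞ F) {q : ℝ × M}
    (hq : q ∈ mongeHypersurface F) (v : ℝ × E) :
    v ∈ tangentVectors (𝓘(ℝ, ℝ).prod 𝓘(ℝ, E)) (mongeHypersurface F) q ↔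
      v.1 = mvfderiv 𝓘(ℝ, E) F q.2 v.2 := by
  constructor
  · intro hv
    have h := mvfderiv_eq_zero_of_mem_tangentVectors hv (f := heightFunction F)
      ((contMDiff_heightFunction hF).mdifferentiable (by simp) _)
      (Filter.Eventually.of_forall fun y hy ↦ sub_eq_zero.2 hy)
    rw [mvfderiv_heightFunction hF] at h
    linarith
  · intro hv
    obtain ⟨t, x⟩ := q
    obtain ⟨s, w⟩ := v
    obtain rfl : t = F x := hq
    obtain ⟨c, hc, hcw⟩ := exists_contMDiffAt_tangentMap_eq x w
    have hgr : ContMDiff 𝓘(ℝ, E) (𝓘(ℝ, ℝ).prod 𝓘(ℝ, E)) ∞ (fun y ↦ (F y, y)) :=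
      hF.prodMk contMDiff_id
    refine ⟨(fun y ↦ (F y, y)) ∘ c, hgr.contMDiffAt.comp _ hc,
      Filter.Eventually.of_forall fun t ↦ rfl, ?_⟩
    rw [tangentMap_comp_at _ (hgr.mdifferentiable (by simp) _) (hc.mdifferentiableAt (by simp)),
      hcw]
    have h := mfderiv_prodMk (I := 𝓘(ℝ, E)) (I' := 𝓘(ℝ, ℝ)) (I'' := 𝓘(ℝ, E))
      (hF.mdifferentiable (by simp) x) (mdifferentiableAt_id (x := x))
    refine congrArg (fun u : ℝ × E ↦ (⟨(F x, x), u⟩ : TangentBundle (𝓘(ℝ, ℝ).prod 𝓘(ℝ, E)) (ℝ × M)))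
      ((congrArg (fun L ↦ L w) h).trans ?_)
    refine Prod.ext hv.symm ?_
    exact congrArg (fun L ↦ L w) (mfderiv_id (I := 𝓘(ℝ, E)) (x := x))

variable [FiniteDimensional ℝ E] (g : SemiRiemannianMetric 𝓘(ℝ, E) M)

/-- For vector fields `X`, `Y` tangent to `{x⁰ = F}`, the component of `∇_X Y` transverse to the
hypersurface is given by the Hessian of `F`. -/
theorem mvfderiv_heightFunction_leviCivita (hF : ContMDiff 𝓘(ℝ, E) 𝓘(ℝ) ∞ F)
    {X Y : Π q : ℝ × M, TangentSpace (𝓘(ℝ, ℝ).prod 𝓘(ℝ, E)) q} {q : ℝ × M}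
    (hX : MDiffAt (T% X) q) (hY : MDiffAt (T% Y) q)
    (hXS : X q ∈ tangentVectors (𝓘(ℝ, ℝ).prod 𝓘(ℝ, E)) (mongeHypersurface F) q)
    (hYS : ∀ᶠ y in 𝓝 q, y ∈ mongeHypersurface F →
      Y y ∈ tangentVectors (𝓘(ℝ, ℝ).prod 𝓘(ℝ, E)) (mongeHypersurface F) y) :
    mvfderiv (𝓘(ℝ, ℝ).prod 𝓘(ℝ, E)) (heightFunction F) q
      ((ambientMetric g).leviCivita Y q (X q)) = g.hessian hF q.2 (X q).2 (Y q).2 := by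
  have hH := contMDiff_heightFunction hF
  have h1 := (ambientMetric g).hessian_apply hH hX hY
  have h2 := mvfderiv_eq_zero_of_mem_tangentVectors hXS
    (SemiRiemannianMetric.mdifferentiableAt_mvfderiv_apply hH hY) (by
      filter_upwards [hYS] with y hy hyS
      have := (mem_tangentVectors_mongeHypersurface hF hyS (Y y)).1 (hy hyS)
      exact (mvfderiv_heightFunction hF y (Y y)).trans (sub_eq_zero.2 this))
  have h3 := hessian_heightFunction g hF q (X q) (Y q)
  rw [h2] at h1
  linarith

omit [FiniteDimensional ℝ E] in
theorem form_eq_of_normal (hF : ContMDiff 𝓘(ℝ, E) 𝓘(ℝ) ∞ F) {q : ℝ × M}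
    (hq : q ∈ mongeHypersurface F) {ξ : ℝ × E}
    (hξ : ∀ v ∈ tangentVectors (𝓘(ℝ, ℝ).prod 𝓘(ℝ, E)) (mongeHypersurface F) q,
      (ambientMetric g).form q ξ v = 0) (u : ℝ × E) :
    (ambientMetric g).form q u ξ =
      -(ξ.1 * mvfderiv (𝓘(ℝ, ℝ).prod 𝓘(ℝ, E)) (heightFunction F) q u) := by
  have h1 := hξ ((mvfderiv 𝓘(ℝ, E) F q.2 u.2, u.2) : ℝ × E)
    ((mem_tangentVectors_mongeHypersurface hF hq (_, _)).2 rfl)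
  have h2 := (ambientMetric_form g q ξ (mvfderiv 𝓘(ℝ, E) F q.2 u.2, u.2)).symm.trans h1
  have h3 := g.symm q.2 u.2 ξ.2
  rw [ambientMetric_form, mvfderiv_heightFunction hF]
  dsimp only at h2
  linarith

/-- The second fundamental form of `{x⁰ = F}` with respect to a normal field `ξ`. -/
theorem secondFundamentalForm_mongeHypersurface (hF : ContMDiff 𝓘(ℝ, E) 𝓘(ℝ) ∞ F)
    {ξ X Y : Π q : ℝ × M, TangentSpace (𝓘(ℝ, ℝ).prod 𝓘(ℝ, E)) q} {q : ℝ × M}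
    (hq : q ∈ mongeHypersurface F)
    (hξ : ∀ v ∈ tangentVectors (𝓘(ℝ, ℝ).prod 𝓘(ℝ, E)) (mongeHypersurface F) q,
      (ambientMetric g).form q (ξ q) v = 0)
    (hX : MDiffAt (T% X) q) (hY : MDiffAt (T% Y) q)
    (hXS : X q ∈ tangentVectors (𝓘(ℝ, ℝ).prod 𝓘(ℝ, E)) (mongeHypersurface F) q)
    (hYS : ∀ᶠ y in 𝓝 q, y ∈ mongeHypersurface F →
      Y y ∈ tangentVectors (𝓘(ℝ, ℝ).prod 𝓘(ℝ, E)) (mongeHypersurface F) y) :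
    (ambientMetric g).secondFundamentalForm ξ X Y q =
      -((ξ q).1 * g.hessian hF q.2 (X q).2 (Y q).2) := by
  rw [SemiRiemannianMetric.secondFundamentalForm,
    ← mvfderiv_heightFunction_leviCivita g hF hX hY hXS hYS]
  exact form_eq_of_normal g hF hq hξ _

omit [FiniteDimensional ℝ E] in
/-- The metric on vectors tangent to `{x⁰ = F}`. -/
theorem ambientMetric_form_of_mem_tangentVectors (hF : ContMDiff 𝓘(ℝ, E) 𝓘(ℝ) ∞ F) {q : ℝ × M}
    (hq : q ∈ mongeHypersurface F) {v w : ℝ × E}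
    (hv : v ∈ tangentVectors (𝓘(ℝ, ℝ).prod 𝓘(ℝ, E)) (mongeHypersurface F) q)
    (hw : w ∈ tangentVectors (𝓘(ℝ, ℝ).prod 𝓘(ℝ, E)) (mongeHypersurface F) q) :
    (ambientMetric g).form q v w =
      -(mvfderiv 𝓘(ℝ, E) F q.2 v.2 * mvfderiv 𝓘(ℝ, E) F q.2 w.2 - g.form q.2 v.2 w.2) := by
  rw [ambientMetric_form, (mem_tangentVectors_mongeHypersurface hF hq v).1 hv,
    (mem_tangentVectors_mongeHypersurface hF hq w).1 hw]
  ring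

end Monge

section Main

variable {E : Type*} [NormedAddCommGroup E] [NormedSpace ℝ E] [FiniteDimensional ℝ E]
  {M : Type*} [TopologicalSpace M] [ChartedSpace E M] [IsManifold 𝓘(ℝ, E) ∞ M]
  (g : SemiRiemannianMetric 𝓘(ℝ, E) M) {F : M → ℝ}

omit [FiniteDimensional ℝ E] in
theorem fst_ne_zero_of_normal (hF : ContMDiff 𝓘(ℝ, E) 𝓘(ℝ) ∞ F) {q : ℝ × M}
    (hq : q ∈ mongeHypersurface F) {ξ : ℝ × E}
    (hξ : ∀ v ∈ tangentVectors (𝓘(ℝ, ℝ).prod 𝓘(ℝ, E)) (mongeHypersurface F) q,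
      (ambientMetric g).form q ξ v = 0) (h0 : ξ ≠ 0) : ξ.1 ≠ 0 := by
  refine fun h ↦ h0 ((ambientMetric g).nondegenerate q ξ fun w ↦ ?_)
  have h1 := form_eq_of_normal g hF hq hξ w
  rw [h, zero_mul, neg_zero] at h1
  exact ((ambientMetric g).symm q ξ w).trans h1

omit [FiniteDimensional ℝ E] in
/-- The `∂₀`-component of a smooth vector field on `ℝ × M` is smooth. -/
theorem contMDiffOn_fst_vectorField {ξ : Π q : ℝ × M, TangentSpace (𝓘(ℝ, ℝ).prod 𝓘(ℝ, E)) q}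
    {V : Set (ℝ × M)} (hξ : CMDiff[V] ∞ (T% ξ)) :
    ContMDiffOn (𝓘(ℝ, ℝ).prod 𝓘(ℝ, E)) 𝓘(ℝ) ∞ (fun q ↦ ((ξ q).1 : ℝ)) V := by
  have h1 := (contMDiff_equivTangentBundleProd (I := 𝓘(ℝ, ℝ)) (M := ℝ) (I' := 𝓘(ℝ, E)) (M' := M)
    (n := ∞)).comp_contMDiffOn hξ
  exact (contMDiff_snd_tangentBundle_modelSpace (I := 𝓘(ℝ, ℝ))).comp_contMDiffOn
    (contMDiff_fst.comp_contMDiffOn h1)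

theorem hessian_eq_of_isTotallyUmbilical (hF : ContMDiff 𝓘(ℝ, E) 𝓘(ℝ) ∞ F)
    (h : (ambientMetric g).IsTotallyUmbilical (mongeHypersurface F)) (p : M) :
    ∃ U : Set M, IsOpen U ∧ p ∈ U ∧
      ∃ ρ : M → ℝ, ContMDiffOn 𝓘(ℝ, E) 𝓘(ℝ) ∞ ρ U ∧
        ∀ x ∈ U, ∀ v w : TangentSpace 𝓘(ℝ, E) x,
          g.hessian hF x v w =
            ρ x * (mvfderiv 𝓘(ℝ, E) F x v * mvfderiv 𝓘(ℝ, E) F x w - g.form x v w) := by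
  obtain ⟨V, hV, hpV, ξ, hξ, hn, ρ, hρ, hB⟩ := h (F p, p) rfl
  have hgr : ContMDiff 𝓘(ℝ, E) (𝓘(ℝ, ℝ).prod 𝓘(ℝ, E)) ∞ (fun y ↦ (F y, y)) :=
    hF.prodMk contMDiff_id
  have hne (x : M) (hx : (F x, x) ∈ V) : ((ξ (F x, x)).1 : ℝ) ≠ 0 :=
    fst_ne_zero_of_normal g hF (q := (F x, x)) rfl (hn _ ⟨rfl, hx⟩).2 (hn _ ⟨rfl, hx⟩).1
  refine ⟨(fun x ↦ (F x, x)) ⁻¹' V, hV.preimage hgr.continuous, hpV,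
    fun x ↦ ρ (F x, x) / ((ξ (F x, x)).1 : ℝ), ?_, ?_⟩
  · exact (hρ.comp hgr.contMDiffOn fun x hx ↦ hx).div₀
      ((contMDiffOn_fst_vectorField hξ).comp hgr.contMDiffOn fun x hx ↦ hx) hne
  · intro x hx v w
    have hW : IsOpen (V ∩ Prod.snd ⁻¹' (chartAt E x).source) :=
      hV.inter ((chartAt E x).open_source.preimage continuous_snd)
    have hqW : (F x, x) ∈ V ∩ Prod.snd ⁻¹' (chartAt E x).source := ⟨hx, mem_chart_source E x⟩
    have hext (v : TangentSpace 𝓘(ℝ, E) x) :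
        CMDiff[V ∩ Prod.snd ⁻¹' (chartAt E x).source] ∞
          (T% (liftField (fun q ↦ mvfderiv 𝓘(ℝ, E) F q.2 (extend E v q.2)) (extend E v))) := by
      have hv := contMDiffOn_extend (I := 𝓘(ℝ, E)) v
      have ha : ContMDiffOn 𝓘(ℝ, E) 𝓘(ℝ) ∞ (fun y ↦ mvfderiv 𝓘(ℝ, E) F y (extend E v y))
          (chartAt E x).source :=
        (contMDiff_snd_tangentBundle_modelSpace (I := 𝓘(ℝ, ℝ))).comp_contMDiffOn
          ((hF.contMDiff_tangentMap (m := ∞) (by simp)).comp_contMDiffOn hv)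
      have hmaps : MapsTo Prod.snd (V ∩ Prod.snd ⁻¹' (chartAt E x).source)
          (chartAt E x).source := fun q hq ↦ hq.2
      exact fun q hq ↦ ContMDiffWithinAt.liftField hmaps
        ((ha.comp contMDiffOn_snd hmaps) q hq) (hv q.2 hq.2)
    have hself (v : TangentSpace 𝓘(ℝ, E) x) : extend E v x = v := extend_apply_self ..
    have htan (v : TangentSpace 𝓘(ℝ, E) x) (q : ℝ × M) (hq : q ∈ mongeHypersurface F) :
        liftField (fun q ↦ mvfderiv 𝓘(ℝ, E) F q.2 (extend E v q.2)) (extend E v) q ∈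
          tangentVectors (𝓘(ℝ, ℝ).prod 𝓘(ℝ, E)) (mongeHypersurface F) q :=
      (mem_tangentVectors_mongeHypersurface hF hq _).2 rfl
    have hmd (v : TangentSpace 𝓘(ℝ, E) x) : MDiffAt
        (T% (liftField (fun q ↦ mvfderiv 𝓘(ℝ, E) F q.2 (extend E v q.2)) (extend E v)))
        (F x, x) :=
      ((hext v).contMDiffAt (hW.mem_nhds hqW)).mdifferentiableAt (by simp)
    have h1 := hB _ hW inter_subset_left _ _ (hext v) (hext w)
      (fun y hy ↦ ⟨htan v y hy.1, htan w y hy.1⟩) (F x, x) ⟨rfl, hqW⟩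
    have h2 := secondFundamentalForm_mongeHypersurface g hF (q := (F x, x)) rfl
      (hn _ ⟨rfl, hx⟩).2 (hmd v) (hmd w) (htan v _ rfl)
      (Filter.Eventually.of_forall fun y hy ↦ htan w y hy)
    have h3 := ambientMetric_form_of_mem_tangentVectors g hF (q := (F x, x)) rfl
      (htan v _ rfl) (htan w _ rfl)
    have h4 := h2.symm.trans (h1.trans (congrArg (ρ (F x, x) * ·) h3))
    simp only [liftField, hself] at h4
    have h5 := hne x hx
    rw [div_mul_eq_mul_div, eq_div_iff h5]
    linarith

theorem isTotallyUmbilical_of_hessian_eq (hF : ContMDiff 𝓘(ℝ, E) 𝓘(ℝ) ∞ F)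
    (h : ∀ p : M, ∃ U : Set M, IsOpen U ∧ p ∈ U ∧
      ∃ ρ : M → ℝ, ContMDiffOn 𝓘(ℝ, E) 𝓘(ℝ) ∞ ρ U ∧
        ∀ x ∈ U, ∀ v w : TangentSpace 𝓘(ℝ, E) x,
          g.hessian hF x v w =
            ρ x * (mvfderiv 𝓘(ℝ, E) F x v * mvfderiv 𝓘(ℝ, E) F x w - g.form x v w)) :
    (ambientMetric g).IsTotallyUmbilical (mongeHypersurface F) := by
  intro q hq
  obtain ⟨U, hU, hqU, ρ, hρ, hH⟩ := h q.2
  have hn (y : ℝ × M) (hy : y ∈ mongeHypersurface F) :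
      ∀ v ∈ tangentVectors (𝓘(ℝ, ℝ).prod 𝓘(ℝ, E)) (mongeHypersurface F) y,
        (ambientMetric g).form y (liftField (fun _ ↦ 1) (g.gradient F) y) v = 0 := by
    intro v hv
    have h1 : mvfderiv (𝓘(ℝ, ℝ).prod 𝓘(ℝ, E)) (heightFunction F) y v = 0 :=
      (mvfderiv_heightFunction hF y v).trans
        (sub_eq_zero.2 ((mem_tangentVectors_mongeHypersurface hF hy v).1 hv))
    exact ((ambientMetric g).symm y _ v).trans
      ((ambientMetric_form_gradient g hF y v).trans (neg_eq_zero.2 h1))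
  refine ⟨Prod.snd ⁻¹' U, hU.preimage continuous_snd, hqU, liftField (fun _ ↦ 1) (g.gradient F),
    ?_, ?_, fun y ↦ ρ y.2, hρ.comp contMDiffOn_snd fun y hy ↦ hy, ?_⟩
  · exact fun y hy ↦ ContMDiffWithinAt.liftField (U := univ) (mapsTo_univ _ _) contMDiffWithinAt_const
      (g.contMDiff_gradient hF y.2).contMDiffWithinAt
  · exact fun y hy ↦ ⟨fun h0 ↦ one_ne_zero (congrArg Prod.fst h0 : (1 : ℝ) = 0), hn y hy.1⟩
  · intro W hW hWU X Y hX hY hXY y hy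
    have hWy : W ∈ 𝓝 y := hW.mem_nhds hy.2
    have h1 := secondFundamentalForm_mongeHypersurface g hF hy.1 (hn y hy.1)
      ((hX.contMDiffAt hWy).mdifferentiableAt (by simp))
      ((hY.contMDiffAt hWy).mdifferentiableAt (by simp)) (hXY y hy).1 (by
        filter_upwards [hWy] with z hz hzS using (hXY z ⟨hzS, hz⟩).2)
    have h2 := ambientMetric_form_of_mem_tangentVectors g hF hy.1 (hXY y hy).1 (hXY y hy).2
    have h3 := hH y.2 (hWU hy.2) (X y).2 (Y y).2
    have h4 : ((liftField (fun _ ↦ (1 : ℝ)) (g.gradient F) y).1 : ℝ) = 1 := rfl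
    rw [h4, one_mul] at h1
    refine h1.trans ?_
    refine Eq.trans ?_ (congrArg (ρ y.2 * ·) h2).symm
    linarith

end Main

end

theorem mainTheorem2 {E : Type*} [NormedAddCommGroup E] [NormedSpace ℝ E] [FiniteDimensional ℝ E]
    {M : Type*} [TopologicalSpace M] [ChartedSpace E M] [IsManifold 𝓘(ℝ, E) ∞ M]
    (g : SemiRiemannianMetric 𝓘(ℝ, E) M) (F : M → ℝ) (hF : ContMDiff 𝓘(ℝ, E) 𝓘(ℝ) ∞ F) :
    (ambientMetric g).IsTotallyUmbilical (mongeHypersurface F) ↔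
      ∀ p : M, ∃ U : Set M, IsOpen U ∧ p ∈ U ∧
        ∃ ρ : M → ℝ, ContMDiffOn 𝓘(ℝ, E) 𝓘(ℝ) ∞ ρ U ∧
          ∀ x ∈ U, ∀ v w : TangentSpace 𝓘(ℝ, E) x,
            g.hessian hF x v w =
              ρ x * (mvfderiv 𝓘(ℝ, E) F x v * mvfderiv 𝓘(ℝ, E) F x w - g.form x v w) := by
  exact ⟨hessian_eq_of_isTotallyUmbilical g hF, isTotallyUmbilical_of_hessian_eq g hF⟩
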